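/- Let $K$ be a number field with algebraic closure $\overline K$, and let $a,b,c\in K[t]$ be polynomials with $b$ constant and $c$ nonconstant. Put $$\phi_t(x)=\frac{x^2+b\,x}{c(t)\,x+1},$$ and for a positive integer $N$ let $Y^{\mathrm{pre}}(N)\subset\mathbb A^2$ (coordinates $x,t$) be the algebraic set defined by the polynomial equation obtained from $\phi_t^N(x)-a(t)=0$ by clearing denominators, where $\phi_t^N$ is the $N$-th iterate of $\phi_t$. Let $Y^{\mathrm{pre}}(N,1),\dots,Y^{\mathrm{pre}}(N,r_N)$ be the irreducible components of $Y^{\mathrm{pre}}(N)$ over $\overline K$. For a component $Y=Y^{\mathrm{pre}}(N,i)$ let $\deg_x Y$ be the degree in $x$ of an irreducible polynomial in $\overline K[x,t]$ defining $Y$; let the points at infinity of $Y$ be the points of the complete nonsingular curve over $\overline K$ with function field $\overline K(Y)$ that do not lie on the normalization of $Y$; and let $L$ be the minimal field of definition of $Y$ over $K$, that is, the smallest field $K\subseteq L\subseteq\overline K$ such that the ideal of $Y$ in $\overline K[x,t]$ is generated by polynomials with coefficients in $L$. Then for every $N\ge 1$ and every $i\in\{1,\dots,r_N\}$, the curve $Y^{\mathrm{pre}}(N,i)$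 has at least $$1+\log_2\deg_x Y^{\mathrm{pre}}(N,i)$$ $\mathrm{Gal}(\overline K/L)$-orbits of points at infinity, where $L$ is the minimal field of definition of $Y^{\mathrm{pre}}(N,i)$ over $K$. -/

import Mathlib

open Polynomial
open scoped Pointwise

namespace Preimage

noncomputable section

/-! ### The preimage curves

The ring `R[X][X]` is the ring of polynomials in `t` (inner variable) and `x` (outer variable). -/

section Equation

variable {R : Type*} [CommRing R]

/-- With `φ_t(x) = (x² + b(t) x) / (c(t) x + 1)`, the numerator and the denominator of the `n`-th
iterate `φ_t^n(x)`: if `φ_t^n(x) = P / Q`, then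
`φ_t^(n+1)(x) = (P² + b P Q) / (c P Q + Q²)`. -/
def iterNumDen (b c : R[X]) : ℕ → R[X][X] × R[X][X]
  | 0 => (X, 1)
  | n + 1 =>
    let P := (iterNumDen b c n).1
    let Q := (iterNumDen b c n).2
    (P ^ 2 + C b * P * Q, C c * P * Q + Q ^ 2)

/-- The equation `φ_t^N(x) - a(t) = 0` after clearing denominators. -/
def preimagePoly (a b c : R[X]) (N : ℕ) : R[X][X] :=
  (iterNumDen b c N).1 - C a * (iterNumDen b c N).2

theorem iterNumDen_eval_zero (b c : R[X]) (n : ℕ) :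
    (iterNumDen b c n).1.eval 0 = 0 ∧ (iterNumDen b c n).2.eval 0 = 1 := by
  induction n with
  | zero => simp [iterNumDen]
  | succ n ih => simp [iterNumDen, ih.1, ih.2]

theorem iterNumDen_snd_ne_zero [Nontrivial R] (b c : R[X]) (n : ℕ) :
    (iterNumDen b c n).2 ≠ 0 := by
  intro h
  have := (iterNumDen_eval_zero b c n).2
  rw [h] at this
  simp at this

/-- In the field of rational functions in `t` and `x`, the quotient of `iterNumDen b c n` is the
`n`-th iterate of `φ_t`, evaluated at `x`. -/
theorem iterNumDen_div [IsDomain R] (b c : R[X]) (n : ℕ) :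
    algebraMap R[X][X] (FractionRing R[X][X]) (iterNumDen b c n).1 /
        algebraMap R[X][X] (FractionRing R[X][X]) (iterNumDen b c n).2 =
      (fun z : FractionRing R[X][X] =>
        (z ^ 2 + algebraMap R[X][X] (FractionRing R[X][X]) (C b) * z) /
          (algebraMap R[X][X] (FractionRing R[X][X]) (C c) * z + 1))^[n]
        (algebraMap R[X][X] (FractionRing R[X][X]) X) := by
  induction n with
  | zero => simp [iterNumDen]
  | succ n ih =>
    have inj := IsFractionRing.injective R[X][X] (FractionRing R[X][X])
    have hQ : algebraMap R[X][X] (FractionRing R[X][X]) (iterNumDen b c n).2 ≠ 0 := by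
      simpa using iterNumDen_snd_ne_zero b c n
    have hQ' : algebraMap R[X][X] (FractionRing R[X][X]) (iterNumDen b c (n + 1)).2 ≠ 0 := by
      simpa using iterNumDen_snd_ne_zero b c (n + 1)
    rw [Function.iterate_succ_apply', ← ih]
    simp only [iterNumDen, map_add, map_mul, map_pow] at hQ' ⊢
    have h2 : algebraMap R[X][X] (FractionRing R[X][X]) (C c) *
        algebraMap R[X][X] (FractionRing R[X][X]) (iterNumDen b c n).1 +
        algebraMap R[X][X] (FractionRing R[X][X]) (iterNumDen b c n).2 ≠ 0 := by
      intro h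
      apply hQ'
      linear_combination algebraMap R[X][X] (FractionRing R[X][X]) (iterNumDen b c n).2 * h
    have h3 : algebraMap R[X][X] (FractionRing R[X][X]) (C c) *
        (algebraMap R[X][X] (FractionRing R[X][X]) (iterNumDen b c n).1 /
        algebraMap R[X][X] (FractionRing R[X][X]) (iterNumDen b c n).2) + 1 ≠ 0 := by
      intro h
      apply h2
      field_simp at h
      simpa using h
    rw [div_eq_div_iff hQ' h3]
    field_simp

end Equation

section Curve

variable {K Kbar : Type*} [Field K] [Field Kbar] [Algebra K Kbar]

/-- Extension of scalars from `K[t][x]` to `Kbar[t][x]`. -/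
def extendScalars (K Kbar : Type*) [Field K] [Field Kbar] [Algebra K Kbar] : K[X][X] →+* Kbar[X][X] :=
  mapRingHom (mapRingHom (algebraMap K Kbar))

/-- The ideal of `Kbar[t][x]` generated by the equation of the preimage curve `Y^pre(N)`. -/
def preimageIdeal (Kbar : Type*) [Field Kbar] [Algebra K Kbar] (a b c : K[X]) (N : ℕ) : Ideal Kbar[X][X] :=
  Ideal.span {extendScalars K Kbar (preimagePoly a b c N)}

/-- The closed subset of the affine plane over `Kbar` with ideal `p` is defined over `L`: its ideal is
generated by polynomials with coefficients in `L`. -/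
def IsDefinedOver (p : Ideal Kbar[X][X]) (L : IntermediateField K Kbar) : Prop :=
  p = Ideal.span {f | f ∈ p ∧ f ∈ Set.range (extendScalars L Kbar)}

/-- The coordinate ring of the closed subset of the affine plane with ideal `p`. -/
def CoordinateRing (p : Ideal Kbar[X][X]) : Type _ := Kbar[X][X] ⧸ p

instance (p : Ideal Kbar[X][X]) : CommRing (CoordinateRing p) := Ideal.Quotient.commRing p

instance (p : Ideal Kbar[X][X]) [p.IsPrime] : IsDomain (CoordinateRing p) :=
  Ideal.Quotient.isDomain p

/-- The restriction of a polynomial in `t` and `x` to the closed subset with ideal `p`. -/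
def CoordinateRing.mk (p : Ideal Kbar[X][X]) : Kbar[X][X] →+* CoordinateRing p :=
  Ideal.Quotient.mk p

theorem CoordinateRing.mk_surjective (p : Ideal Kbar[X][X]) :
    Function.Surjective (CoordinateRing.mk p) :=
  Ideal.Quotient.mk_surjective

/-- The function field of the irreducible closed subset with prime ideal `p`. -/
abbrev FunctionField (p : Ideal Kbar[X][X]) [p.IsPrime] : Type _ :=
  FractionRing (CoordinateRing p)

/-- The points at infinity of the affine plane curve `Y` with prime ideal `p` over an algebraically
closed field `Kbar`. The points of the complete nonsingular curve with function field `Kbar(Y)` are the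
nontrivial valuation rings of `Kbar(Y)` that contain `Kbar`, and the points of the normalization of `Y`
are those which contain the coordinate ring `Kbar[Y]`; the points at infinity are the remaining ones
(a ring that does not contain `Kbar[Y]` is automatically nontrivial). -/
def pointsAtInfinity (p : Ideal Kbar[X][X]) [p.IsPrime] : Set (ValuationSubring (FunctionField p)) :=
  {v | (∀ k : Kbar, algebraMap (CoordinateRing p) (FunctionField p)
      (CoordinateRing.mk p (C (C k))) ∈ v) ∧
    ¬ ∀ f : CoordinateRing p, algebraMap (CoordinateRing p) (FunctionField p) f ∈ v}

/-- The action of a field automorphism on the coefficients of polynomials in `t` and `x`. -/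
def coeffAut {L : IntermediateField K Kbar} (σ : Kbar ≃ₐ[L] Kbar) : Kbar[X][X] ≃+* Kbar[X][X] :=
  Polynomial.mapEquiv (Polynomial.mapEquiv σ.toRingEquiv)

theorem coeffAut_extendScalars {L : IntermediateField K Kbar} (σ : Kbar ≃ₐ[L] Kbar) (g : L[X][X]) :
    coeffAut σ (extendScalars L Kbar g) = extendScalars L Kbar g := by
  ext i j
  simpa [coeffAut, extendScalars, coeff_map] using σ.commutes ((g.coeff i).coeff j)

theorem IsDefinedOver.map_le {p : Ideal Kbar[X][X]} {L : IntermediateField K Kbar}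
    (h : IsDefinedOver p L) (σ : Kbar ≃ₐ[L] Kbar) : p.map (coeffAut σ : Kbar[X][X] →+* Kbar[X][X]) ≤ p := by
  conv_lhs => rw [h]
  rw [Ideal.map_span, Ideal.span_le]
  rintro _ ⟨f, ⟨hf, g, rfl⟩, rfl⟩
  have : (coeffAut σ : Kbar[X][X] →+* Kbar[X][X]) (extendScalars L Kbar g) = extendScalars L Kbar g :=
    coeffAut_extendScalars σ g
  rw [SetLike.mem_coe, this]
  exact hf

theorem coeffAut_one {L : IntermediateField K Kbar} (f : Kbar[X][X]) :
    coeffAut (1 : Kbar ≃ₐ[L] Kbar) f = f := by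
  ext i j
  simp [coeffAut, coeff_map]

theorem coeffAut_mul {L : IntermediateField K Kbar} (σ τ : Kbar ≃ₐ[L] Kbar) (f : Kbar[X][X]) :
    coeffAut (σ * τ) f = coeffAut σ (coeffAut τ f) := by
  ext i j
  simp [coeffAut, coeff_map]

theorem IsDefinedOver.eq_map {p : Ideal Kbar[X][X]} {L : IntermediateField K Kbar}
    (h : IsDefinedOver p L) (σ : Kbar ≃ₐ[L] Kbar) :
    p = p.map (coeffAut σ : Kbar[X][X] →+* Kbar[X][X]) := by
  refine le_antisymm (fun f hf => ?_) (h.map_le σ)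
  have h1 : coeffAut σ⁻¹ f ∈ p := h.map_le σ⁻¹ (Ideal.mem_map_of_mem _ hf)
  have h2 := Ideal.mem_map_of_mem (coeffAut σ : Kbar[X][X] →+* Kbar[X][X]) h1
  have h3 : (coeffAut σ : Kbar[X][X] →+* Kbar[X][X]) (coeffAut σ⁻¹ f) = f := by
    change coeffAut σ (coeffAut σ⁻¹ f) = f
    rw [← coeffAut_mul, mul_inv_cancel, coeffAut_one]
  rwa [h3] at h2

/-- If `Y` is defined over `L`, then `Gal(Kbar/L)` acts on the coordinate ring of `Y` through the
coefficients of polynomials. -/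
def coordinateRingAut (p : Ideal Kbar[X][X]) (L : IntermediateField K Kbar)
    (h : IsDefinedOver p L) (σ : Kbar ≃ₐ[L] Kbar) : CoordinateRing p ≃+* CoordinateRing p :=
  Ideal.quotientEquiv p p (coeffAut σ) (h.eq_map σ)

theorem coordinateRingAut_mk (p : Ideal Kbar[X][X]) (L : IntermediateField K Kbar)
    (h : IsDefinedOver p L) (σ : Kbar ≃ₐ[L] Kbar) (f : Kbar[X][X]) :
    coordinateRingAut p L h σ (CoordinateRing.mk p f) = CoordinateRing.mk p (coeffAut σ f) :=
  rfl

/-- If `Y` is defined over `L`, then `Gal(Kbar/L)` acts on the function field of `Y`: it acts on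
the constants `Kbar` in the natural way and fixes the coordinate functions `t` and `x`. -/
def galoisAction (p : Ideal Kbar[X][X]) [p.IsPrime] (L : IntermediateField K Kbar)
    (h : IsDefinedOver p L) : (Kbar ≃ₐ[L] Kbar) →* RingAut (FunctionField p) where
  toFun σ := IsFractionRing.ringEquivOfRingEquiv (coordinateRingAut p L h σ)
  map_one' := by
    ext z
    obtain ⟨f, g, -, rfl⟩ := IsFractionRing.div_surjective (A := CoordinateRing p) z
    obtain ⟨f, rfl⟩ := CoordinateRing.mk_surjective p f
    obtain ⟨g, rfl⟩ := CoordinateRing.mk_surjective p g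
    simp [coordinateRingAut_mk, coeffAut_one]
  map_mul' σ τ := by
    ext z
    obtain ⟨f, g, -, rfl⟩ := IsFractionRing.div_surjective (A := CoordinateRing p) z
    obtain ⟨f, rfl⟩ := CoordinateRing.mk_surjective p f
    obtain ⟨g, rfl⟩ := CoordinateRing.mk_surjective p g
    simp [coordinateRingAut_mk, coeffAut_mul]

/-- The set of `Gal(Kbar/L)`-orbits of points at infinity of a curve `Y` that is defined over `L`. -/
def orbitsAtInfinity (p : Ideal Kbar[X][X]) [p.IsPrime] (L : IntermediateField K Kbar)
    (h : IsDefinedOver p L) : Set (Set (ValuationSubring (FunctionField p))) :=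
  {O | ∃ v ∈ pointsAtInfinity p,
    O = {w | ∃ σ : Kbar ≃ₐ[L] Kbar, w = galoisAction p L h σ • v}}

end Curve

end

end Preimage

namespace Preimage

/-! Write `k` for the algebraically closed constants. The relation `y = φ_t(x)` makes `x` a root of
`X² - (c y - b) X - y`, so `x` and its conjugate `x'` satisfy `x + x' = c y - b` and `x x' = -y`.
Iterating `φ_t` gives a tower from `k(t)`, where the last iterate is `a(t)`, up to the function
field of the component; each step has degree 1 or 2.

Every quadratic step produces a new Galois orbit of places over `t = ∞`. The cleared equation is
monic in `x`, so `y` is integral over `k[t]` and cannot vanish at all these places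
(`exists_mem_placesAtInfinity_inv_mem`). Take a place where `y` does not vanish. There `c` has a
pole and the constant `b` does not, so the two relations force exactly one of `x`, `x'` to have a
pole (`mem_iff_conjugate_notMem`). Hence one place of `k(t, y)` has two extensions to `k(t, x)`,
separated by whether `x` has a pole (`exists_valuationSubring_conjugate`). Galois fixes `x`, so it
cannot exchange them, and one of the two is new (`exists_insert_pairwise_not_conjugateOn`). Starting
from degree 1 and one orbit, induction gives `2 deg ≤ 2 ^ (number of orbits)`
(`exists_pairwise_not_conjugateOn`).

Monicity also identifies the points at infinity with the places where `t` has a pole, and gives the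
ideal of the component a monic generator, whose coefficients generate the minimal field of
definition. -/

open scoped IntermediateField

/-! ### Extension and finiteness of valuation rings. -/

theorem exists_valuationSubring_comap_eq {M F : Type*} [Field M] [Field F] (f : M →+* F)
    (A : ValuationSubring M) : ∃ W : ValuationSubring F, W.comap f = A := by
  obtain ⟨W, hle, hloc⟩ := (A.toLocalSubring.map f).exists_le_valuationSubring
  refine ⟨W, le_antisymm (fun z hz => ?_) fun z hz => hle ⟨z, hz, rfl⟩⟩
  -- `W` dominates the image of `A`: the inverse of `z` would lie in `A` and become a unit in `W`,
  -- hence already be a unit in `A`.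
  by_contra hzA
  have hz0 : z ≠ 0 := fun h => hzA (h ▸ A.zero_mem)
  have hinv : z⁻¹ ∈ A := (A.mem_or_inv_mem z).resolve_left hzA
  have hunit : IsUnit (Subring.inclusion hle ⟨f z⁻¹, z⁻¹, hinv, rfl⟩) :=
    isUnit_iff_exists_inv.mpr ⟨⟨f z, hz⟩, Subtype.ext (by
      change f z⁻¹ * f z = 1
      rw [← map_mul, inv_mul_cancel₀ hz0, map_one])⟩
  obtain ⟨⟨_, w, hw, rfl⟩, h⟩ := isUnit_iff_exists_inv.mp (hloc.map_nonunit _ hunit)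
  have h1 : f z⁻¹ * f w = 1 := congrArg Subtype.val h
  rw [← map_mul, map_eq_one_iff f f.injective, inv_mul_eq_one₀ hz0] at h1
  exact hzA (h1 ▸ hw)

/-- The center of `v` on `B` is a prime dividing `s`, of which there are finitely many, and it
determines `v`: the valuation ring at a height-one prime has no proper overring except the whole
field. -/
theorem finite_valuationSubring_of_isDedekindDomain {B F : Type*} [CommRing B] [IsDedekindDomain B]
    [Field F] [Algebra B F] [IsFractionRing B F] {s : B} (hs : s ≠ 0) :
    {v : ValuationSubring F | (∀ b : B, algebraMap B F b ∈ v) ∧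
      algebraMap B F s ∈ v.nonunits}.Finite := by
  have hI : Ideal.span {s} ≠ 0 := by simpa using hs
  refine ((Ideal.finite_factors hI).image
    (IsDedekindDomain.HeightOneSpectrum.valuationSubringAtPrime F)).subset ?_
  rintro v ⟨hv, hsv⟩
  let g : B →+* v := (algebraMap B F).codRestrict v hv
  have hmem (b : B) : b ∈ (IsLocalRing.maximalIdeal v).comap g ↔ algebraMap B F b ∈ v.nonunits :=
    (ValuationSubring.coe_mem_nonunits_iff (a := g b)).symm
  have hsP : s ∈ (IsLocalRing.maximalIdeal v).comap g := (hmem s).mpr hsv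
  let P : IsDedekindDomain.HeightOneSpectrum B :=
    ⟨(IsLocalRing.maximalIdeal v).comap g, inferInstance, fun h => hs (by simpa [h] using hsP)⟩
  refine ⟨P, Ideal.dvd_span_singleton.mpr hsP, ?_⟩
  refine ValuationSubring.eq_of_le_of_ne_top _ ?_ ?_
  · rintro _ ⟨a, d, hd, rfl⟩
    refine v.mul_mem _ _ (hv a) ?_
    have : algebraMap B F d ∉ v.nonunits := fun h => hd ((hmem d).mpr h)
    rw [ValuationSubring.mem_nonunits_iff_or] at this
    push Not at this
    exact this.2
  · rintro rfl
    rw [ValuationSubring.mem_nonunits_iff_or] at hsv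
    simp [hs] at hsv

/-! ### Places of a function field above the pole of `t`. -/

section Transcendental

variable {k F : Type*} [Field k] [Field F] [Algebra k F]

theorem isPrincipalIdealRing_adjoin_singleton (s : F) :
    IsPrincipalIdealRing (Algebra.adjoin k {s}) := by
  have h : Function.Surjective ((aeval s : k[X] →ₐ[k] F).rangeRestrict) :=
    AlgHom.rangeRestrict_surjective _
  have := IsPrincipalIdealRing.of_surjective _ h
  rw [Algebra.adjoin_singleton_eq_range_aeval]
  exact this

open scoped IntermediateField.algebraAdjoinAdjoin in
-- `k[s]` is a principal ideal ring, hence integrally closed, so the minimal polynomial has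
-- coefficients in it. The field `κ` is kept separate from `k⟮s⟯` so that `s = t⁻¹` can be used with
-- `κ = k⟮t⟯`.
theorem exists_aeval_eq_coeff_minpoly {s : F} {κ : IntermediateField k F} (hκ : κ = k⟮s⟯) {x : F}
    (hx : IsIntegral (Algebra.adjoin k {s}) x) (i : ℕ) :
    ∃ p : k[X], aeval s p = ((minpoly κ x).coeff i : F) := by
  subst hκ
  have := isPrincipalIdealRing_adjoin_singleton (k := k) s
  rw [minpoly.isIntegrallyClosed_eq_field_fractions' k⟮s⟯ hx, coeff_map]
  have h := ((minpoly (Algebra.adjoin k {s}) x).coeff i).2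
  obtain ⟨p, hp⟩ := (Algebra.adjoin_singleton_eq_range_aeval k s).le h
  exact ⟨p, hp⟩

theorem mem_valuationSubring_of_isIntegral_adjoin {v : ValuationSubring F}
    (hv : ∀ c : k, algebraMap k F c ∈ v) {S : Set F} (hS : S ⊆ v) {x : F}
    (hx : IsIntegral (Algebra.adjoin k S) x) : x ∈ v := by
  have hle : ∀ z ∈ Algebra.adjoin k S, z ∈ v := fun z hz =>
    Algebra.adjoin_induction (p := fun z _ => z ∈ v) (fun z hz => hS hz) hv
      (fun _ _ _ _ h1 h2 => v.add_mem _ _ h1 h2) (fun _ _ _ _ h1 h2 => v.mul_mem _ _ h1 h2) hz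
  let g : Algebra.adjoin k S →+* v := (algebraMap _ F).codRestrict v fun z => hle z z.2
  have hxv : IsIntegral v x := by
    obtain ⟨p, hp, hpx⟩ := hx
    refine ⟨p.map g, hp.map g, ?_⟩
    rw [eval₂_map]
    exact hpx
  obtain ⟨y, rfl⟩ := IsIntegrallyClosed.isIntegral_iff.mp hxv
  exact y.2

open scoped IntermediateField.algebraAdjoinAdjoin in
theorem finite_valuationSubring_of_mem_nonunits [CharZero k] {s : F} (hs : s ≠ 0)
    [FiniteDimensional k⟮s⟯ F] :
    {v : ValuationSubring F | (∀ c : k, algebraMap k F c ∈ v) ∧ s ∈ v.nonunits}.Finite := by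
  have := isPrincipalIdealRing_adjoin_singleton (k := k) s
  have : CharZero k⟮s⟯ := charZero_of_injective_algebraMap (algebraMap k k⟮s⟯).injective
  have := integralClosure.isDedekindDomain (Algebra.adjoin k {s}) k⟮s⟯ F
  have : IsFractionRing (integralClosure (Algebra.adjoin k {s}) F) F :=
    integralClosure.isFractionRing_of_finite_extension k⟮s⟯ F
  let s' : integralClosure (Algebra.adjoin k {s}) F :=
    algebraMap (Algebra.adjoin k {s}) _ ⟨s, Algebra.self_mem_adjoin_singleton k s⟩
  have hs' : algebraMap _ F s' = s := rfl
  refine (finite_valuationSubring_of_isDedekindDomain (F := F) (s := s') ?_).subset ?_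
  · intro h
    apply hs
    rw [← hs', h, map_zero]
  · rintro v ⟨hv, hsv⟩
    refine ⟨fun b => mem_valuationSubring_of_isIntegral_adjoin hv (S := {s}) ?_ b.2, hsv⟩
    simpa using ValuationSubring.nonunits_subset hsv

/-- The valuation subrings of an extension of `k` that contain `k` and do not contain `t`. -/
def placesAtInfinity (k : Type*) {F : Type*} [Field k] [Field F] [Algebra k F] (t : F) :
    Set (ValuationSubring F) :=
  {v | (∀ c : k, algebraMap k F c ∈ v) ∧ t ∉ v}

theorem aeval_notMem_of_mem_placesAtInfinity {t : F} {v : ValuationSubring F}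
    (hv : v ∈ placesAtInfinity k t) {p : k[X]} (hp : p.natDegree ≠ 0) :
    aeval t p ∉ v := by
  have htinv : t⁻¹ ∈ v := (v.mem_or_inv_mem t).resolve_left hv.2
  have ht0 : t ≠ 0 := fun h => hv.2 (h ▸ v.zero_mem)
  obtain ⟨n, hn⟩ := Nat.exists_eq_succ_of_ne_zero hp
  clear hp
  induction n generalizing p with
  | zero =>
    intro h
    rw [eq_X_add_C_of_natDegree_le_one hn.le] at h
    have hlc : p.coeff 1 ≠ 0 := by
      have := leadingCoeff_ne_zero.mpr (ne_zero_of_natDegree_gt (n := 0) (by rw [hn]; exact Nat.one_pos))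
      rwa [leadingCoeff, hn] at this
    have h1 := sub_mem h (hv.1 (p.coeff 0))
    have h2 := v.mul_mem _ _ (hv.1 (p.coeff 1)⁻¹) h1
    simp only [map_add, map_mul, aeval_C, aeval_X, add_sub_cancel_right, ← mul_assoc] at h2
    rw [← map_mul, inv_mul_cancel₀ hlc, map_one, one_mul] at h2
    exact hv.2 h2
  | succ n ih =>
    intro h
    apply ih (p := p.divX) (by rw [natDegree_divX_eq_natDegree_tsub_one, hn]; rfl)
    rw [← divX_mul_X_add p] at h
    -- Subtracting the constant term and dividing by `t` lowers the degree by one and stays in `v`,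
    -- since `t⁻¹ ∈ v`.
    have h1 := v.mul_mem _ _ (sub_mem h (hv.1 (p.coeff 0))) htinv
    simpa [ht0] using h1

/-- Since `t⁻¹` is transcendental, it is not a unit of `k[t⁻¹]`, so some valuation ring over
`k[t⁻¹]` has it as a nonunit. -/
theorem placesAtInfinity_nonempty {t : F} (ht : Transcendental k t) :
    (placesAtInfinity k t).Nonempty := by
  have ht0 : t ≠ 0 := fun h => ht (h ▸ isAlgebraic_zero)
  have htr : Transcendental k t⁻¹ := fun h => ht (by simpa using h.inv)
  let s : (Algebra.adjoin k {t⁻¹}).toSubring := ⟨t⁻¹, Algebra.self_mem_adjoin_singleton k t⁻¹⟩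
  have hI : Ideal.span {s} ≠ ⊤ := by
    rw [Ne, Ideal.span_singleton_eq_top, isUnit_iff_exists_inv]
    rintro ⟨⟨z, hz⟩, h⟩
    rw [Subalgebra.mem_toSubring, Algebra.adjoin_singleton_eq_range_aeval] at hz
    obtain ⟨p, rfl⟩ := hz
    have h1 : aeval t⁻¹ (X * p - 1) = 0 := by
      have : t⁻¹ * aeval t⁻¹ p = 1 := congrArg Subtype.val h
      simp [this]
    have h2 := congrArg (eval 0) (transcendental_iff.mp htr _ h1)
    simp at h2
  obtain ⟨v, hle, hv⟩ := Ideal.image_subset_nonunits_valuationSubring _ hI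
  refine ⟨v, fun c => hle (Subalgebra.algebraMap_mem _ c), ?_⟩
  have : t⁻¹ ∈ v.nonunits := hv ⟨s, Ideal.mem_span_singleton_self s, rfl⟩
  exact (v.inv_mem_nonunits_iff.mp this).resolve_left ht0

theorem adjoin_inv_singleton (t : F) : k⟮t⁻¹⟯ = k⟮t⟯ := by
  refine le_antisymm ?_ ?_ <;> rw [IntermediateField.adjoin_simple_le_iff]
  · exact inv_mem (IntermediateField.mem_adjoin_simple_self k t)
  · simpa using inv_mem (IntermediateField.mem_adjoin_simple_self k t⁻¹)

open scoped IntermediateField.algebraAdjoinAdjoin in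
-- Each coefficient of the minimal polynomial over `k(t)` is a polynomial in `t` and also in `t⁻¹`.
-- It has no pole at infinity, so it is constant.
theorem isAlgebraic_of_isIntegral_adjoin_of_isIntegral_adjoin_inv {t : F}
    (ht : Transcendental k t) {x : F} (hx : IsIntegral (Algebra.adjoin k {t}) x)
    (hx' : IsIntegral (Algebra.adjoin k {t⁻¹}) x) : IsAlgebraic k x := by
  obtain ⟨v, hv⟩ := placesAtInfinity_nonempty ht
  have hcoeff (i : ℕ) : ((minpoly k⟮t⟯ x).coeff i : F) ∈ (algebraMap k F).range := by
    obtain ⟨p, hp⟩ := exists_aeval_eq_coeff_minpoly rfl hx i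
    obtain ⟨q, hq⟩ := exists_aeval_eq_coeff_minpoly (adjoin_inv_singleton t).symm hx' i
    have hqv : aeval t⁻¹ q ∈ v := mem_valuationSubring_of_isIntegral_adjoin (S := {t⁻¹}) hv.1
      (by simpa using (v.mem_or_inv_mem t).resolve_left hv.2)
      (isIntegral_algebraMap (x := (⟨aeval t⁻¹ q, aeval_mem_adjoin_singleton k t⁻¹⟩ :
        Algebra.adjoin k {t⁻¹})))
    rw [hq, ← hp] at hqv
    have hdeg : p.natDegree = 0 := by
      by_contra h
      exact aeval_notMem_of_mem_placesAtInfinity hv h hqv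
    obtain ⟨c, rfl⟩ := natDegree_eq_zero.mp hdeg
    rw [← hp]
    exact ⟨c, by simp⟩
  have hint : IsIntegral k⟮t⟯ x := hx.tower_top
  have hmon : ((minpoly k⟮t⟯ x).map (algebraMap k⟮t⟯ F)).Monic := (minpoly.monic hint).map _
  obtain ⟨q, hq⟩ := (mem_lifts ((minpoly k⟮t⟯ x).map (algebraMap k⟮t⟯ F))).mp
    ((lifts_iff_coeff_lifts _).mpr fun i => by
      rw [coeff_map]
      exact hcoeff i)
  refine ⟨q, ?_, ?_⟩
  · rintro rfl
    exact hmon.ne_zero (by simpa using hq.symm)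
  · rw [aeval_def, ← eval_map, hq, eval_map, ← aeval_def, minpoly.aeval]

/-- If `x` vanished at every place at infinity, it would have no poles at all and so be algebraic
over `k`. Then `x⁻¹` would be algebraic too, hence lie in every valuation ring containing `k`. -/
theorem exists_mem_placesAtInfinity_inv_mem {t : F} (ht : Transcendental k t)
    {x : F} (hx : IsIntegral (Algebra.adjoin k {t}) x) :
    ∃ v ∈ placesAtInfinity k t, x⁻¹ ∈ v := by
  by_contra! H
  have hmem : x ∈ (integralClosure (Algebra.adjoin k {t⁻¹}) F).toSubring := by
    by_contra hx'
    have : IsIntegrallyClosedIn (integralClosure (Algebra.adjoin k {t⁻¹}) F).toSubring F :=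
      inferInstanceAs (IsIntegrallyClosedIn (integralClosure (Algebra.adjoin k {t⁻¹}) F) F)
    obtain ⟨v, hle, hxv⟩ := Subring.exists_le_valuationSubring_of_isIntegrallyClosedIn hx'
    have hk (c : k) : algebraMap k F c ∈ v :=
      hle (Subalgebra.algebraMap_mem (integralClosure (Algebra.adjoin k {t⁻¹}) F)
        (algebraMap k (Algebra.adjoin k {t⁻¹}) c))
    by_cases htv : t ∈ v
    · exact hxv (mem_valuationSubring_of_isIntegral_adjoin hk (by simpa using htv) hx)
    · exact hxv ((v.mem_or_inv_mem x).resolve_right (H v ⟨hk, htv⟩))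
  obtain ⟨v, hv⟩ := placesAtInfinity_nonempty ht
  have halg := (isAlgebraic_of_isIntegral_adjoin_of_isIntegral_adjoin_inv ht hx hmem).inv
  refine H v hv (mem_valuationSubring_of_isIntegral_adjoin hv.1 (Set.empty_subset _) ?_)
  exact halg.isIntegral.tower_top

theorem finite_placesAtInfinity [CharZero k] {t : F} [FiniteDimensional k⟮t⟯ F] :
    (placesAtInfinity k t).Finite := by
  by_cases ht0 : t = 0
  · convert Set.finite_empty
    ext v
    simp [placesAtInfinity, ht0]
  have : FiniteDimensional k⟮t⁻¹⟯ F := by rwa [adjoin_inv_singleton]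
  refine (finite_valuationSubring_of_mem_nonunits (k := k) (inv_ne_zero ht0)).subset ?_
  rintro v ⟨hv, htv⟩
  exact ⟨hv, v.inv_mem_nonunits_iff.mpr (Or.inr htv)⟩

end Transcendental

/-! ### Monicity of the cleared equation in `x`. -/

section Monic

variable {R : Type*} [CommRing R]

theorem degree_C_mul_le_degree (r : R) (p : R[X]) : (C r * p).degree ≤ p.degree := by
  rw [← smul_eq_C_mul]
  exact degree_smul_le r p

variable [Nontrivial R]

theorem iterNumDen_monic_natDegree_degree (b c : R[X]) (n : ℕ) :
    (iterNumDen b c n).1.Monic ∧ (iterNumDen b c n).1.natDegree = 2 ^ n ∧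
      (iterNumDen b c n).2.degree < (2 ^ n : ℕ) := by
  induction n with
  | zero => simp [iterNumDen, monic_X]
  | succ n ih =>
    obtain ⟨hP, hPn, hQ⟩ := ih
    have hPd : (iterNumDen b c n).1.degree = (2 ^ n : ℕ) := by
      rw [degree_eq_natDegree hP.ne_zero, hPn]
    have hpow : ((2 ^ (n + 1) : ℕ) : WithBot ℕ) = (2 ^ n : ℕ) + (2 ^ n : ℕ) := by
      rw [← Nat.cast_add, pow_succ, mul_two]
    have hCmul (r : R[X]) : (C r * (iterNumDen b c n).1 * (iterNumDen b c n).2).degree <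
        (2 ^ (n + 1) : ℕ) := by
      rw [mul_assoc, hpow]
      refine lt_of_le_of_lt (degree_C_mul_le_degree _ _) ?_
      rw [hP.degree_mul_comm, hP.degree_mul, hPd, add_comm]
      exact WithBot.add_lt_add_left (WithBot.coe_ne_bot) hQ
    have hP2 : ((iterNumDen b c n).1 ^ 2).natDegree = 2 ^ (n + 1) := by
      rw [hP.natDegree_pow, hPn, pow_succ, mul_comm]
    have hP2d : ((iterNumDen b c n).1 ^ 2).degree = (2 ^ (n + 1) : ℕ) := by
      rw [degree_eq_natDegree (hP.pow 2).ne_zero, hP2]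
    refine ⟨(hP.pow 2).add_of_left (by rw [hP2d]; exact hCmul b), ?_, ?_⟩
    · refine natDegree_eq_of_degree_eq_some ?_
      rw [iterNumDen, degree_add_eq_left_of_degree_lt (by rw [hP2d]; exact hCmul b), hP2d]
    · refine lt_of_le_of_lt (degree_add_le _ _) (max_lt (hCmul c) ?_)
      have hQn := (natDegree_lt_iff_degree_lt (iterNumDen_snd_ne_zero b c n)).mpr hQ
      refine degree_le_natDegree.trans_lt (Nat.cast_lt.mpr ?_)
      rw [pow_succ 2 n, mul_comm]
      exact natDegree_pow_le.trans_lt (Nat.mul_lt_mul_of_pos_left hQn two_pos)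

theorem preimagePoly_monic (a b c : R[X]) (N : ℕ) : (preimagePoly a b c N).Monic := by
  obtain ⟨hP, hPn, hQ⟩ := iterNumDen_monic_natDegree_degree b c N
  refine hP.sub_of_left ?_
  rw [degree_eq_natDegree hP.ne_zero, hPn]
  exact lt_of_le_of_lt (degree_C_mul_le_degree _ _) hQ

end Monic

/-! ### Evaluating the iterates along the tower. -/

section Evaluation

variable {k F : Type*} [Field k] [Field F] [Algebra k F]

/-- Evaluation of a polynomial in `t` (inner variable) and `x` (outer variable). -/
noncomputable def evalAt (k : Type*) {F : Type*} [Field k] [Field F] [Algebra k F] (t x : F) :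
    k[X][X] →+* F :=
  eval₂RingHom (aeval t : k[X] →ₐ[k] F) x

@[simp]
theorem evalAt_C (t x : F) (p : k[X]) : evalAt k t x (C p) = aeval t p := by
  simp [evalAt]

@[simp]
theorem evalAt_X (t x : F) : evalAt k t x X = x := by
  simp [evalAt]

theorem isIntegral_of_evalAt_eq_zero {t x : F} {f : k[X][X]} (hf : f.Monic)
    (h : evalAt k t x f = 0) : IsIntegral (Algebra.adjoin k {t}) x := by
  let g : k[X] →+* Algebra.adjoin k {t} :=
    (aeval t : k[X] →ₐ[k] F).toRingHom.codRestrict _ fun p => aeval_mem_adjoin_singleton k t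
  refine ⟨f.map g, hf.map g, ?_⟩
  rw [eval₂_map]
  exact h

/-- The recursion of `iterNumDen` applies `φ_t` on the outside; this peels it off on the inside.
Numerator and denominator are homogeneous of degree `2 ^ n`, which gives the common factor. -/
theorem evalAt_iterNumDen_succ (b c : k[X]) {t x y : F}
    (hy : y * (aeval t c * x + 1) = x ^ 2 + aeval t b * x) (n : ℕ) :
    evalAt k t y (iterNumDen b c n).1 * (aeval t c * x + 1) ^ 2 ^ n =
        evalAt k t x (iterNumDen b c (n + 1)).1 ∧
      evalAt k t y (iterNumDen b c n).2 * (aeval t c * x + 1) ^ 2 ^ n =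
        evalAt k t x (iterNumDen b c (n + 1)).2 := by
  induction n with
  | zero => simp [iterNumDen, hy]
  | succ n ih =>
    have hstep (m : ℕ) : iterNumDen b c (m + 1) =
      ((iterNumDen b c m).1 ^ 2 + C b * (iterNumDen b c m).1 * (iterNumDen b c m).2,
        C c * (iterNumDen b c m).1 * (iterNumDen b c m).2 + (iterNumDen b c m).2 ^ 2) := rfl
    rw [hstep (n + 1), hstep n] at *
    simp only [map_add, map_mul, map_pow, evalAt_C] at ih ⊢
    rw [← ih.1, ← ih.2, pow_succ 2 n, pow_mul]
    constructor <;> ring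

/-- A pole of `φ_t` goes to `∞`, a fixed point of `φ_t`, so all further denominators vanish. -/
theorem evalAt_iterNumDen_of_eq_zero (b c : k[X]) {t x : F} (h : aeval t c * x + 1 = 0) (n : ℕ) :
    evalAt k t x (iterNumDen b c (n + 1)).1 = (x ^ 2 + aeval t b * x) ^ 2 ^ n ∧
      evalAt k t x (iterNumDen b c (n + 1)).2 = 0 := by
  induction n with
  | zero => simp [iterNumDen, h]
  | succ n ih =>
    rw [iterNumDen]
    simp only [map_add, map_mul, map_pow, evalAt_C, ih.1, ih.2]
    constructor <;> ring

/-- At a pole the equation reduces to the vanishing of a power of `x (x + β)`. The root `0` is not a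
pole, and `-β` would give `c β = 1` with `c` nonconstant. -/
theorem aeval_mul_add_one_ne_zero (a : k[X]) (β : k) {c : k[X]} (hc : c.natDegree ≠ 0) {t x : F}
    (ht : Transcendental k t) {n : ℕ} (hx : evalAt k t x (preimagePoly a (C β) c (n + 1)) = 0) :
    aeval t c * x + 1 ≠ 0 := by
  intro h
  obtain ⟨h1, h2⟩ := evalAt_iterNumDen_of_eq_zero (C β) c h n
  rw [preimagePoly, map_sub, map_mul, h1, h2, mul_zero, sub_zero] at hx
  have h3 : x * (x + algebraMap k F β) = 0 := by
    have := eq_zero_of_pow_eq_zero hx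
    rw [aeval_C] at this
    linear_combination this
  rcases mul_eq_zero.mp h3 with h4 | h4
  · simp [h4] at h
  · refine hc ?_
    have h5 : aeval t (c * C β - 1) = 0 := by
      simp only [map_sub, map_mul, aeval_C, map_one]
      linear_combination -h + aeval t c * h4
    have h6 := transcendental_iff.mp ht _ h5
    exact natDegree_eq_zero_of_isUnit (IsUnit.of_mul_eq_one _ (sub_eq_zero.mp h6))

end Evaluation

/-! ### Splitting of a place in a quadratic step. -/

section Splitting

theorem mem_iff_conjugate_notMem {F : Type*} [Field F] {v : ValuationSubring F}
    {x x' y b c : F} (hsum : x + x' = c * y - b) (hprod : x * x' = -y)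
    (hb : b ∈ v) (hc : c ∉ v) (hy0 : y ≠ 0) (hy : y⁻¹ ∈ v) : x ∈ v ↔ x' ∉ v := by
  constructor
  · intro hx hx'
    apply hc
    have h := v.mul_mem _ _ (add_mem (add_mem hx hx') hb) hy
    rwa [hsum, sub_add_cancel, mul_assoc, mul_inv_cancel₀ hy0, mul_one] at h
  · intro hx'
    by_contra hx
    apply hc
    have hx0 : x ≠ 0 := fun h => hx (h ▸ v.zero_mem)
    have hx0' : x' ≠ 0 := fun h => hx' (h ▸ v.zero_mem)
    have h1 := (v.mem_or_inv_mem x).resolve_left hx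
    have h2 := (v.mem_or_inv_mem x').resolve_left hx'
    -- This element is `b / y - (1 / x + 1 / x')`, which equals `c`.
    have h := sub_mem (v.mul_mem _ _ hb hy) (add_mem h1 h2)
    convert h using 1
    have hxx : x⁻¹ + x'⁻¹ = (x + x') / (x * x') := by field_simp; ring
    rw [hxx, hsum, hprod]
    field_simp
    ring

/-- The `E`-embedding of `E(x)` into `F` sending `x` to `x'` pulls `v` back to a valuation ring of
`E(x)`; `W` is any extension of it to `F`. -/
theorem exists_valuationSubring_conjugate {E F : Type*} [Field E] [Field F] [Algebra E F]
    (v : ValuationSubring F) {x x' : F} {u w : E} (hx : x ∉ (algebraMap E F).range)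
    (hsum : x + x' = algebraMap E F u) (hprod : x * x' = algebraMap E F w) :
    ∃ W : ValuationSubring F, (∀ z : E, algebraMap E F z ∈ W ↔ algebraMap E F z ∈ v) ∧
      (x ∈ W ↔ x' ∈ v) := by
  let q : E[X] := X ^ 2 - C u * X + C w
  have hqd : q.natDegree = 2 := by
    dsimp only [q]; compute_degree!
  have hqm : q.Monic := by
    dsimp only [q]; monicity!
  have hqx : aeval x q = 0 := by
    simp only [q, map_add, map_sub, map_mul, map_pow, aeval_X, aeval_C, ← hsum, ← hprod]
    ring
  have hqx' : aeval x' q = 0 := by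
    simp only [q, map_add, map_sub, map_mul, map_pow, aeval_X, aeval_C, ← hsum, ← hprod]
    ring
  have hint : IsIntegral E x := ⟨q, hqm, hqx⟩
  have hmin : minpoly E x = q := by
    refine (eq_of_monic_of_dvd_of_natDegree_le (minpoly.monic hint) hqm (minpoly.dvd _ _ hqx) ?_).symm
    rw [hqd]
    exact (minpoly.two_le_natDegree_iff hint).mpr hx
  let pb := IntermediateField.adjoin.powerBasis hint
  have hgen : algebraMap E⟮x⟯ F pb.gen = x := by
    simp [pb, IntermediateField.adjoin.powerBasis_gen]
  have hroot : aeval x' (minpoly E pb.gen) = 0 := by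
    rw [← minpoly.algebraMap_eq (algebraMap E⟮x⟯ F).injective, hgen, hmin, hqx']
  let τ : E⟮x⟯ →ₐ[E] F := pb.lift x' hroot
  obtain ⟨W, hW⟩ := exists_valuationSubring_comap_eq (algebraMap E⟮x⟯ F) (v.comap (τ : E⟮x⟯ →+* F))
  have hmem (z : E⟮x⟯) : algebraMap E⟮x⟯ F z ∈ W ↔ τ z ∈ v := by
    rw [← ValuationSubring.mem_comap, hW, ValuationSubring.mem_comap]
    rfl
  refine ⟨W, fun z => ?_, ?_⟩
  · have := hmem (algebraMap E E⟮x⟯ z)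
    rwa [← IsScalarTower.algebraMap_apply, AlgHom.commutes] at this
  · have := hmem pb.gen
    rwa [hgen, PowerBasis.lift_gen] at this

end Splitting

/-! ### Counting conjugacy classes of places up the tower. -/

section Tower

variable {k F : Type*} [Field k] [Field F] [Algebra k F]

/-- Two valuation subrings of `F` have conjugate restrictions to the subset `E`, under a group
acting on `F` through `ρ`. -/
def ConjugateOn {Γ : Type*} [Group Γ] (ρ : Γ →* RingAut F) (E : Set F)
    (v w : ValuationSubring F) : Prop :=
  ∃ σ : Γ, ∀ z ∈ E, z ∈ v ↔ ρ σ z ∈ w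

variable {Γ : Type*} [Group Γ] {ρ : Γ →* RingAut F} {E E' : Set F} {v v' w u : ValuationSubring F}

theorem ConjugateOn.mono (h : ConjugateOn ρ E v w) (hE : E' ⊆ E) : ConjugateOn ρ E' v w :=
  let ⟨σ, hσ⟩ := h
  ⟨σ, fun z hz => hσ z (hE hz)⟩

theorem ConjugateOn.symm (hE : ∀ σ, ∀ z ∈ E, ρ σ z ∈ E) (h : ConjugateOn ρ E v w) :
    ConjugateOn ρ E w v := by
  obtain ⟨σ, hσ⟩ := h
  refine ⟨σ⁻¹, fun z hz => ?_⟩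
  rw [hσ _ (hE _ _ hz), ← RingAut.mul_apply, ← map_mul, mul_inv_cancel, map_one, RingAut.one_apply]

theorem ConjugateOn.trans (hE : ∀ σ, ∀ z ∈ E, ρ σ z ∈ E) (h : ConjugateOn ρ E v w)
    (h' : ConjugateOn ρ E w u) : ConjugateOn ρ E v u := by
  obtain ⟨σ, hσ⟩ := h
  obtain ⟨τ, hτ⟩ := h'
  refine ⟨τ * σ, fun z hz => ?_⟩
  rw [hσ z hz, hτ _ (hE _ _ hz), map_mul, RingAut.mul_apply]

theorem ConjugateOn.of_eqOn (h : ∀ z ∈ E, z ∈ v ↔ z ∈ w) : ConjugateOn ρ E v w :=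
  ⟨1, fun z hz => by rw [map_one, RingAut.one_apply, h z hz]⟩

theorem apply_mem_adjoin_adjoin {t x : F} (hk : ∀ σ (r : k), ρ σ (algebraMap k F r) ∈ (algebraMap k F).range)
    (hρt : ∀ σ, ρ σ t = t) (hρx : ∀ σ, ρ σ x = x) (σ : Γ) {z : F} (hz : z ∈ k⟮t⟯⟮x⟯) :
    ρ σ z ∈ k⟮t⟯⟮x⟯ := by
  have hκ (z : F) (hz : z ∈ k⟮t⟯) : ρ σ z ∈ k⟮t⟯ := by
    induction hz using IntermediateField.adjoin_induction with
    | mem z hz =>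
      rw [Set.mem_singleton_iff] at hz
      rw [hz, hρt]
      exact IntermediateField.mem_adjoin_simple_self k t
    | algebraMap r =>
      obtain ⟨s, hs⟩ := hk σ r
      rw [← hs]
      exact IntermediateField.algebraMap_mem _ s
    | add _ _ _ _ h1 h2 => rw [map_add]; exact add_mem h1 h2
    | inv _ _ h => rw [map_inv₀]; exact inv_mem h
    | mul _ _ _ _ h1 h2 => rw [map_mul]; exact mul_mem h1 h2
  induction hz using IntermediateField.adjoin_induction with
  | mem z hz =>
    rw [Set.mem_singleton_iff] at hz
    rw [hz, hρx]
    exact IntermediateField.mem_adjoin_simple_self _ x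
  | algebraMap r =>
    exact IntermediateField.algebraMap_mem k⟮t⟯⟮x⟯ ⟨ρ σ (r : F), hκ _ r.2⟩
  | add _ _ _ _ h1 h2 => rw [map_add]; exact add_mem h1 h2
  | inv _ _ h => rw [map_inv₀]; exact inv_mem h
  | mul _ _ _ _ h1 h2 => rw [map_mul]; exact mul_mem h1 h2

theorem finrank_adjoin_le_two_mul {κ : Type*} [Field κ] [Algebra κ F] [FiniteDimensional κ F]
    {x y : F} {u w : F} (hu : u ∈ κ⟮y⟯) (hw : w ∈ κ⟮y⟯) (h : x ^ 2 - u * x + w = 0) :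
    Module.finrank κ κ⟮x⟯ ≤ 2 * Module.finrank κ κ⟮y⟯ := by
  let q : κ⟮y⟯[X] := X ^ 2 - C ⟨u, hu⟩ * X + C ⟨w, hw⟩
  have hqd : q.natDegree = 2 := by
    dsimp only [q]; compute_degree!
  have hqx : aeval x q = 0 := by
    simpa [q] using h
  have h1 : Module.finrank κ⟮y⟯ κ⟮y⟯⟮x⟯ ≤ 2 := by
    rw [IntermediateField.adjoin.finrank (Algebra.IsIntegral.isIntegral x), ← hqd]
    refine natDegree_le_of_dvd (minpoly.dvd _ _ hqx) ?_
    rintro h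
    simp [h] at hqd
  have h2 : κ⟮x⟯ ≤ (κ⟮y⟯⟮x⟯).restrictScalars κ := by
    rw [IntermediateField.adjoin_simple_le_iff]
    exact IntermediateField.mem_adjoin_simple_self _ x
  have h3 : Module.finrank κ ((κ⟮y⟯⟮x⟯).restrictScalars κ) = Module.finrank κ κ⟮y⟯⟮x⟯ := rfl
  refine (IntermediateField.finrank_le_of_le_right h2).trans ?_
  rw [h3, ← Module.finrank_mul_finrank κ κ⟮y⟯ κ⟮y⟯⟮x⟯, mul_comm]
  exact Nat.mul_le_mul_right _ h1

/-- In a set of valuation subrings pairwise not conjugate on `E`, a further element can be added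
when one of the restrictions to `E` has two extensions separated by a fixed element `x`. -/
theorem exists_insert_pairwise_not_conjugateOn (hE : ∀ σ, ∀ z ∈ E, ρ σ z ∈ E) (hEE' : E ⊆ E')
    {x : F} (hxE' : x ∈ E') (hρx : ∀ σ, ρ σ x = x) {T : Finset (ValuationSubring F)}
    (hT : (T : Set (ValuationSubring F)).Pairwise fun v w => ¬ ConjugateOn ρ E v w)
    (hw : ∀ z ∈ E, z ∈ v ↔ z ∈ v') (hxv : x ∈ v) (hxv' : x ∉ v') :
    ∃ w, (w = v ∨ w = v') ∧ ∀ u ∈ T, ¬ ConjugateOn ρ E' u w := by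
  have hsep {u w : ValuationSubring F} (h : ConjugateOn ρ E' u w) : x ∈ u ↔ x ∈ w := by
    obtain ⟨σ, hσ⟩ := h
    rw [hσ x hxE', hρx]
  -- If both candidates were conjugate to members of `T`, these members would differ by the
  -- behaviour of `x`, yet be conjugate on `E`, where the candidates agree.
  by_contra! H
  obtain ⟨u, hu, huv⟩ := H v (Or.inl rfl)
  obtain ⟨u', hu', huv'⟩ := H v' (Or.inr rfl)
  have hne : u ≠ u' := by
    rintro rfl
    exact hxv' ((hsep huv').mp ((hsep huv).mpr hxv))
  exact hT hu hu' hne (((huv.mono hEE').trans hE (.of_eqOn hw)).trans hE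
    ((huv'.mono hEE').symm hE))

/-- Places of the intermediate field `k(t, x)` are represented by valuation rings of the one field
`F`, compared only on that subfield. So `x` can vary in the induction while `F` stays fixed. -/
theorem exists_pairwise_not_conjugateOn [CharZero k] {t : F} (ht : Transcendental k t)
    [FiniteDimensional k⟮t⟯ F] (a c : k[X]) (β : k) (hc : c.natDegree ≠ 0)
    (hk : ∀ σ (r : k), ρ σ (algebraMap k F r) ∈ (algebraMap k F).range)
    (hρt : ∀ σ, ρ σ t = t) (hρb : ∀ σ, ρ σ (algebraMap k F β) = algebraMap k F β)
    (hρc : ∀ σ, ρ σ (aeval t c) = aeval t c) (n : ℕ) {x : F} (hρx : ∀ σ, ρ σ x = x)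
    (hx : evalAt k t x (preimagePoly a (C β) c n) = 0) :
    ∃ T : Finset (ValuationSubring F), ↑T ⊆ placesAtInfinity k t ∧
      ((T : Set (ValuationSubring F)).Pairwise fun v w => ¬ ConjugateOn ρ k⟮t⟯⟮x⟯ v w) ∧
      2 * Module.finrank k⟮t⟯ k⟮t⟯⟮x⟯ ≤ 2 ^ T.card := by
  induction n generalizing x with
  | zero =>
    obtain ⟨v, hv⟩ := placesAtInfinity_nonempty ht
    refine ⟨{v}, by simpa using hv, by simp, ?_⟩
    have hxa : x = aeval t a := by simpa [preimagePoly, iterNumDen, sub_eq_zero] using hx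
    have hxmem : x ∈ k⟮t⟯ := by
      rw [hxa]
      exact IntermediateField.algebra_adjoin_le_adjoin k {t} (aeval_mem_adjoin_singleton k t)
    have hbot : k⟮t⟯⟮x⟯ = ⊥ :=
      IntermediateField.adjoin_simple_eq_bot_iff.mpr (IntermediateField.mem_bot.mpr ⟨⟨x, hxmem⟩, rfl⟩)
    rw [hbot, IntermediateField.finrank_bot]
    simp
  | succ n ih =>
    have hd := aeval_mul_add_one_ne_zero a β hc ht hx
    let y := (x ^ 2 + algebraMap k F β * x) / (aeval t c * x + 1)
    have hy : y * (aeval t c * x + 1) = x ^ 2 + algebraMap k F β * x := div_mul_cancel₀ _ hd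
    have hρy (σ : Γ) : ρ σ y = y := by
      simp only [y, map_div₀, map_add, map_mul, map_pow, hρx, hρb, hρc, map_one]
    have hfy : evalAt k t y (preimagePoly a (C β) c n) = 0 := by
      obtain ⟨h1, h2⟩ := evalAt_iterNumDen_succ (C β) c (t := t) (x := x) (y := y) (by rw [aeval_C]; exact hy) n
      rw [preimagePoly, map_sub, map_mul, ← h1, ← h2, evalAt_C] at hx
      have h3 : evalAt k t y (preimagePoly a (C β) c n) * (aeval t c * x + 1) ^ 2 ^ n = 0 := by
        rw [preimagePoly, map_sub, map_mul, evalAt_C, ← hx]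
        ring
      exact (mul_eq_zero.mp h3).resolve_right (pow_ne_zero _ hd)
    obtain ⟨T, hTsub, hT, hcard⟩ := ih hρy hfy
    have hxmem : x ∈ k⟮t⟯⟮x⟯ := IntermediateField.mem_adjoin_simple_self _ x
    have hk' (z : F) (hz : z ∈ k⟮t⟯) (E : IntermediateField k⟮t⟯ F) : z ∈ E :=
      IntermediateField.algebraMap_mem E ⟨z, hz⟩
    have hβmem : algebraMap k F β ∈ k⟮t⟯ := IntermediateField.algebraMap_mem k⟮t⟯ β
    have hcmem : aeval t c ∈ k⟮t⟯ :=
      IntermediateField.algebra_adjoin_le_adjoin k {t} (aeval_mem_adjoin_singleton k t)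
    have hle : k⟮t⟯⟮y⟯ ≤ k⟮t⟯⟮x⟯ := by
      rw [IntermediateField.adjoin_simple_le_iff]
      exact div_mem (add_mem (pow_mem hxmem 2) (mul_mem (hk' _ hβmem _) hxmem))
        (add_mem (mul_mem (hk' _ hcmem _) hxmem) (one_mem _))
    have hpair : (T : Set (ValuationSubring F)).Pairwise
        fun v w => ¬ ConjugateOn ρ k⟮t⟯⟮x⟯ v w :=
      hT.imp fun v w h h' => h (h'.mono hle)
    -- A step of degree 1 leaves the field, and hence `T`, unchanged; only a quadratic step needs a
    -- new place.
    by_cases hxy : x ∈ k⟮t⟯⟮y⟯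
    · refine ⟨T, hTsub, hpair, ?_⟩
      have : k⟮t⟯⟮x⟯ = k⟮t⟯⟮y⟯ :=
        le_antisymm (IntermediateField.adjoin_simple_le_iff.mpr hxy) hle
      rwa [this]
    · have hymem : y ∈ k⟮t⟯⟮y⟯ := IntermediateField.mem_adjoin_simple_self _ y
      have hy0 : y ≠ 0 := by
        intro h0
        have h1 : x * (x + algebraMap k F β) = 0 := by
          rw [h0, zero_mul] at hy
          linear_combination -hy
        rcases mul_eq_zero.mp h1 with h | h
        · exact hxy (h ▸ zero_mem _)
        · rw [eq_neg_of_add_eq_zero_left h] at hxy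
          exact hxy (neg_mem (hk' _ hβmem _))
      obtain ⟨v, hv, hyv⟩ := exists_mem_placesAtInfinity_inv_mem ht
        (isIntegral_of_evalAt_eq_zero (preimagePoly_monic a (C β) c n) hfy)
      have hcv := aeval_notMem_of_mem_placesAtInfinity hv hc
      -- The other root of the quadratic equation of `x` over `k(t, y)`.
      let x' := aeval t c * y - algebraMap k F β - x
      have hsum : x + x' = aeval t c * y - algebraMap k F β := by simp [x']
      have hprod : x * x' = -y := by
        simp only [x']
        linear_combination hy
      have hxor := mem_iff_conjugate_notMem hsum hprod (hv.1 β) hcv hy0 hyv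
      have hu : aeval t c * y - algebraMap k F β ∈ k⟮t⟯⟮y⟯ :=
        sub_mem (mul_mem (hk' _ hcmem _) hymem) (hk' _ hβmem _)
      obtain ⟨W, hWv, hWx⟩ := exists_valuationSubring_conjugate (E := k⟮t⟯⟮y⟯) v
        (u := ⟨_, hu⟩) (w := ⟨-y, neg_mem hymem⟩) (x := x) (x' := x') (by
          rintro ⟨z, hz⟩
          exact hxy (hz ▸ z.2)) hsum hprod
      have hW : W ∈ placesAtInfinity k t :=
        ⟨fun r => (hWv ⟨_, hk' _ (IntermediateField.algebraMap_mem _ r) _⟩).mpr (hv.1 r),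
          fun h => hv.2 ((hWv ⟨t, hk' _ (IntermediateField.mem_adjoin_simple_self k t) _⟩).mp h)⟩
      have hEy : ∀ σ, ∀ z ∈ (k⟮t⟯⟮y⟯ : Set F), ρ σ z ∈ (k⟮t⟯⟮y⟯ : Set F) := fun σ z hz =>
        apply_mem_adjoin_adjoin hk hρt hρy σ hz
      have hEx : ∀ σ, ∀ z ∈ (k⟮t⟯⟮x⟯ : Set F), ρ σ z ∈ (k⟮t⟯⟮x⟯ : Set F) := fun σ z hz =>
        apply_mem_adjoin_adjoin hk hρt hρx σ hz
      have key : ∃ w ∈ placesAtInfinity k t, ∀ u ∈ T, ¬ ConjugateOn ρ k⟮t⟯⟮x⟯ u w := by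
        -- Exactly one of `v` and `W` contains `x`; the cases only decide which one.
        by_cases hxv : x ∈ v
        · obtain ⟨w, hw, h⟩ := exists_insert_pairwise_not_conjugateOn (v := v) (v' := W) hEy hle
            hxmem hρx hT (fun z hz => (hWv ⟨z, hz⟩).symm) hxv (fun h => hxor.mp hxv (hWx.mp h))
          refine ⟨w, ?_, h⟩
          rcases hw with rfl | rfl <;> assumption
        · obtain ⟨w, hw, h⟩ := exists_insert_pairwise_not_conjugateOn (v := W) (v' := v) hEy hle
            hxmem hρx hT (fun z hz => hWv ⟨z, hz⟩) (hWx.mpr (not_not.mp (mt hxor.mpr hxv))) hxv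
          refine ⟨w, ?_, h⟩
          rcases hw with rfl | rfl <;> assumption
      obtain ⟨w, hw, hwT⟩ := key
      classical
      have hwmem : w ∉ T := fun h => hwT w h (.of_eqOn fun _ _ => Iff.rfl)
      refine ⟨insert w T, ?_, ?_, ?_⟩
      · rw [Finset.coe_insert, Set.insert_subset_iff]
        exact ⟨hw, hTsub⟩
      · rw [Finset.coe_insert]
        exact hpair.insert fun u hu _ => ⟨fun h => hwT u hu (h.symm hEx), hwT u hu⟩
      · rw [Finset.card_insert_of_notMem hwmem, pow_succ, mul_comm (2 ^ _)]
        refine Nat.mul_le_mul_left 2 (le_trans ?_ hcard)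
        refine finrank_adjoin_le_two_mul hu (neg_mem hymem) ?_
        rw [← hsum, ← hprod]
        ring

end Tower

/-! ### Monic generators and the minimal field of definition. -/

theorem exists_monic_eq_span_singleton_of_mem_minimalPrimes {R : Type*} [CommRing R] [IsDomain R]
    [UniqueFactorizationMonoid R] {f : R[X]} (hf : f.Monic) {p : Ideal R[X]}
    (hp : p ∈ (Ideal.span {f}).minimalPrimes) : ∃ G : R[X], G.Monic ∧ p = Ideal.span {G} := by
  have hprime : p.IsPrime := hp.1.1
  have hfp : f ∈ p := hp.1.2 (Ideal.mem_span_singleton_self f)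
  have hprod : (UniqueFactorizationMonoid.factors f).prod ∈ p := by
    obtain ⟨u, hu⟩ := UniqueFactorizationMonoid.factors_prod hf.ne_zero
    rw [← hu] at hfp
    exact (hprime.mem_or_mem hfp).resolve_right fun h =>
      hprime.ne_top (Ideal.eq_top_of_isUnit_mem _ h u.isUnit)
  obtain ⟨g, hg, hgp⟩ := (hprime.multiset_prod_mem_iff_exists_mem _).mp hprod
  have hgprime := UniqueFactorizationMonoid.prime_of_factor g hg
  obtain ⟨h, hgh⟩ := UniqueFactorizationMonoid.dvd_of_mem_factors hg
  have hpg : p = Ideal.span {g} := by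
    have hle : Ideal.span {g} ≤ p := (Ideal.span_singleton_le_iff_mem _).mpr hgp
    refine le_antisymm (hp.2 ⟨(Ideal.span_singleton_prime hgprime.ne_zero).mpr hgprime, ?_⟩ hle) hle
    rw [Ideal.span_singleton_le_span_singleton]
    exact ⟨h, hgh⟩
  -- A factor of a monic polynomial has a unit leading coefficient, so it can be normalized.
  have hlc : h.leadingCoeff * g.leadingCoeff = 1 := by
    rw [mul_comm, ← leadingCoeff_mul, ← hgh, hf.leadingCoeff]
  refine ⟨C h.leadingCoeff * g, ?_, ?_⟩
  · rw [Monic, leadingCoeff_mul, leadingCoeff_C, hlc]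
  · rw [hpg, Ideal.span_singleton_mul_left_unit]
    exact (IsUnit.of_mul_eq_one _ hlc).map C

section DefinedOver

variable {K Kbar : Type*} [Field K] [Field Kbar] [Algebra K Kbar]

theorem mem_range_extendScalars {L : IntermediateField K Kbar} {f : Kbar[X][X]} :
    f ∈ Set.range (extendScalars L Kbar) ↔ ∀ i j, (f.coeff i).coeff j ∈ L := by
  have h : f ∈ Set.range (extendScalars L Kbar) ↔
      f ∈ (mapRingHom (mapRingHom (algebraMap L Kbar))).range := Iff.rfl
  rw [h, mem_map_range]
  refine forall_congr' fun i => ?_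
  rw [mem_map_range]
  refine forall_congr' fun j => ⟨?_, fun hj => ⟨⟨_, hj⟩, rfl⟩⟩
  rintro ⟨z, hz⟩
  rw [← hz]
  exact z.2

/-- The monic generator is unique. Automorphisms over any field of definition therefore fix `G`
itself, and Galois descent puts its coefficients in that field. -/
theorem isLeast_isDefinedOver_span_singleton [IsGalois K Kbar] {G : Kbar[X][X]} (hG : G.Monic) :
    IsLeast {L : IntermediateField K Kbar | IsDefinedOver (Ideal.span {G}) L}
      (IntermediateField.adjoin K {z | ∃ i j, z = (G.coeff i).coeff j}) := by
  constructor
  · refine le_antisymm ?_ (Ideal.span_le.mpr fun f hf => hf.1)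
    rw [Ideal.span_singleton_le_iff_mem]
    refine Ideal.subset_span ⟨Ideal.mem_span_singleton_self G, mem_range_extendScalars.mpr ?_⟩
    exact fun i j => IntermediateField.subset_adjoin K _ ⟨i, j, rfl⟩
  · intro L hL
    rw [IntermediateField.adjoin_le_iff]
    rintro _ ⟨i, j, rfl⟩
    have hfix (σ : Kbar ≃ₐ[L] Kbar) : coeffAut σ G = G := by
      have hmem : coeffAut σ G ∈ Ideal.span {G} :=
        hL.map_le σ (Ideal.mem_map_of_mem _ (Ideal.mem_span_singleton_self G))
      have hσG : coeffAut σ G = G.map (mapRingHom (σ : Kbar →+* Kbar)) := rfl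
      rw [hσG] at hmem ⊢
      exact eq_of_monic_of_dvd_of_natDegree_le hG (hG.map _) (Ideal.mem_span_singleton.mp hmem)
        natDegree_map_le
    have hmem : (G.coeff i).coeff j ∈ (⊥ : IntermediateField L Kbar) := by
      rw [InfiniteGalois.mem_bot_iff_fixed]
      intro σ
      conv_rhs => rw [← hfix σ]
      simp [coeffAut, coeff_map]
    obtain ⟨z, hz⟩ := IntermediateField.mem_bot.mp hmem
    rw [← hz]
    exact z.2

theorem extendScalars_preimagePoly (a b c : K[X]) (N : ℕ) :
    extendScalars K Kbar (preimagePoly a b c N) = preimagePoly (a.map (algebraMap K Kbar))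
      (b.map (algebraMap K Kbar)) (c.map (algebraMap K Kbar)) N := by
  have hC (r : K[X]) : extendScalars K Kbar (C r) = C (r.map (algebraMap K Kbar)) := by
    simp [extendScalars]
  have h (n : ℕ) : extendScalars K Kbar (iterNumDen b c n).1 = (iterNumDen
      (b.map (algebraMap K Kbar)) (c.map (algebraMap K Kbar)) n).1 ∧
      extendScalars K Kbar (iterNumDen b c n).2 = (iterNumDen
      (b.map (algebraMap K Kbar)) (c.map (algebraMap K Kbar)) n).2 := by
    induction n with
    | zero => simp [iterNumDen, extendScalars]
    | succ n ih => simp [iterNumDen, hC, ih.1, ih.2]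
  rw [preimagePoly, preimagePoly, map_sub, map_mul, hC, (h N).1, (h N).2]

theorem coeffAut_C_map {L : IntermediateField K Kbar} (σ : Kbar ≃ₐ[L] Kbar) (g : K[X]) :
    coeffAut σ (C (g.map (algebraMap K Kbar))) = C (g.map (algebraMap K Kbar)) := by
  have : C (g.map (algebraMap K Kbar)) = extendScalars L Kbar (C (g.map (algebraMap K L))) := by
    simp [extendScalars, Polynomial.map_map, ← IsScalarTower.algebraMap_eq]
  rw [this, coeffAut_extendScalars]

theorem galoisAction_algebraMap_mk (p : Ideal Kbar[X][X]) [p.IsPrime] (L : IntermediateField K Kbar)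
    (h : IsDefinedOver p L) (σ : Kbar ≃ₐ[L] Kbar) (f : Kbar[X][X]) :
    galoisAction p L h σ (algebraMap (CoordinateRing p) (FunctionField p) (CoordinateRing.mk p f)) =
      algebraMap (CoordinateRing p) (FunctionField p) (CoordinateRing.mk p (coeffAut σ f)) := by
  change IsFractionRing.ringEquivOfRingEquiv (coordinateRingAut p L h σ) _ = _
  rw [IsFractionRing.ringEquivOfRingEquiv_algebraMap, coordinateRingAut_mk]

end DefinedOver

/-! ### The function field of a component and the final count. -/

section FunctionField

theorem natDegree_le_natDegree_of_mem {k : Type*} [Field k] {p : Ideal k[X][X]} {G f : k[X][X]} (hp : p = Ideal.span {G}) (hf : f ∈ p)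
    (hf0 : f ≠ 0) : G.natDegree ≤ f.natDegree := by
  rw [hp, Ideal.mem_span_singleton] at hf
  exact natDegree_le_of_dvd hf hf0

variable {k : Type*} [Field k] (p : Ideal k[X][X]) [p.IsPrime]

/-- A polynomial in `t` and `x` as an element of the function field of a plane curve. -/
noncomputable def toFunctionField : k[X][X] →+* FunctionField p :=
  (algebraMap (CoordinateRing p) (FunctionField p)).comp (CoordinateRing.mk p)

/-- The function field of a plane curve is an algebra over the field of constants. -/
@[reducible] noncomputable def functionFieldAlgebra : Algebra k (FunctionField p) :=
  ((toFunctionField p).comp (C.comp C)).toAlgebra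

variable {p}

theorem toFunctionField_eq_zero_iff {f : k[X][X]} : toFunctionField p f = 0 ↔ f ∈ p := by
  rw [toFunctionField, RingHom.comp_apply, map_eq_zero_iff _
    (IsFractionRing.injective (CoordinateRing p) (FunctionField p))]
  exact Ideal.Quotient.eq_zero_iff_mem

theorem exists_eq_toFunctionField_div (z : FunctionField p) :
    ∃ f g, z = toFunctionField p f / toFunctionField p g := by
  obtain ⟨f, g, -, rfl⟩ := IsFractionRing.div_surjective (A := CoordinateRing p) z
  obtain ⟨f, rfl⟩ := CoordinateRing.mk_surjective p f
  obtain ⟨g, rfl⟩ := CoordinateRing.mk_surjective p g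
  exact ⟨f, g, rfl⟩

attribute [local instance] functionFieldAlgebra

theorem aeval_toFunctionField (q : k[X]) :
    aeval (toFunctionField p (C X)) q = toFunctionField p (C q) := by
  have : (aeval (toFunctionField p (C X)) : k[X] →ₐ[k] FunctionField p).toRingHom =
      (toFunctionField p).comp C := by
    ext
    · simp
      rfl
    · simp
  exact congrArg (fun g : k[X] →+* FunctionField p => g q) this

theorem evalAt_toFunctionField (f : k[X][X]) :
    evalAt k (toFunctionField p (C X)) (toFunctionField p X) f = toFunctionField p f := by
  have : evalAt k (toFunctionField p (C X)) (toFunctionField p X) = toFunctionField p := by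
    refine Polynomial.ringHom_ext (fun q => ?_) (evalAt_X _ _)
    rw [evalAt_C, aeval_toFunctionField]
  rw [this]

theorem evalAt_mem_adjoin_adjoin {F : Type*} [Field F] [Algebra k F] (t x : F) (f : k[X][X]) :
    evalAt k t x f ∈ k⟮t⟯⟮x⟯ := by
  induction f using Polynomial.induction_on' with
  | add f g hf hg => rw [map_add]; exact add_mem hf hg
  | monomial n q =>
    rw [← C_mul_X_pow_eq_monomial, map_mul, map_pow, evalAt_C, evalAt_X]
    refine mul_mem ?_ (pow_mem (IntermediateField.mem_adjoin_simple_self _ x) n)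
    exact IntermediateField.algebraMap_mem k⟮t⟯⟮x⟯ ⟨aeval t q,
      IntermediateField.algebra_adjoin_le_adjoin k {t} (aeval_mem_adjoin_singleton k t)⟩

theorem adjoin_adjoin_toFunctionField_eq_top :
    k⟮toFunctionField p (C X)⟯⟮toFunctionField p X⟯ = ⊤ := by
  rw [eq_top_iff]
  intro z _
  obtain ⟨f, g, rfl⟩ := exists_eq_toFunctionField_div z
  rw [← evalAt_toFunctionField f, ← evalAt_toFunctionField g]
  exact div_mem (evalAt_mem_adjoin_adjoin _ _ f) (evalAt_mem_adjoin_adjoin _ _ g)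

theorem natDegree_ne_zero_of_monic {G : k[X][X]} (hG : G.Monic) (hp : p = Ideal.span {G}) :
    G.natDegree ≠ 0 := by
  intro h
  refine Ideal.IsPrime.ne_top ‹p.IsPrime› ?_
  rw [hp, eq_one_of_monic_natDegree_zero hG h, Ideal.span_singleton_one]

/-- A nonzero polynomial in `t` alone has degree 0 in `x`, so it cannot be a multiple of `G`, whose
degree in `x` is positive. -/
theorem transcendental_toFunctionField {G : k[X][X]} (hG : G.Monic) (hp : p = Ideal.span {G}) :
    Transcendental k (toFunctionField p (C X)) := by
  rw [transcendental_iff]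
  intro q hq
  rw [aeval_toFunctionField, toFunctionField_eq_zero_iff] at hq
  by_contra hq0
  have := natDegree_le_natDegree_of_mem hp hq (by simpa using hq0)
  rw [natDegree_C] at this
  exact natDegree_ne_zero_of_monic hG hp (Nat.le_zero.mp this)

theorem isIntegral_toFunctionField {f : k[X][X]} (hf : f.Monic) (hfp : f ∈ p) :
    IsIntegral (Algebra.adjoin k {toFunctionField p (C X)}) (toFunctionField p X) :=
  isIntegral_of_evalAt_eq_zero hf
    (by rw [evalAt_toFunctionField, toFunctionField_eq_zero_iff]; exact hfp)

open scoped IntermediateField.algebraAdjoinAdjoin in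
theorem finiteDimensional_functionField {f : k[X][X]} (hf : f.Monic) (hfp : f ∈ p) :
    FiniteDimensional k⟮toFunctionField p (C X)⟯ (FunctionField p) := by
  have hint : IsIntegral k⟮toFunctionField p (C X)⟯ (toFunctionField p X) :=
    (isIntegral_toFunctionField hf hfp).tower_top
  have := IntermediateField.adjoin.finiteDimensional hint
  rw [adjoin_adjoin_toFunctionField_eq_top] at this
  exact Module.Finite.equiv (IntermediateField.topEquiv (F := k⟮toFunctionField p (C X)⟯)
    (E := FunctionField p)).toLinearEquiv

open scoped IntermediateField.algebraAdjoinAdjoin in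
-- By integrality the minimal polynomial of `x` over `k(t)` has coefficients in `k[t]`, so it lifts
-- to a nonzero element of `p`, a multiple of `G`.
theorem natDegree_le_finrank {G : k[X][X]} (hG : G.Monic) (hp : p = Ideal.span {G}) :
    G.natDegree ≤ Module.finrank k⟮toFunctionField p (C X)⟯
      k⟮toFunctionField p (C X)⟯⟮toFunctionField p X⟯ := by
  have hGp : G ∈ p := hp ▸ Ideal.mem_span_singleton_self G
  have hint' := isIntegral_toFunctionField hG hGp
  have hint : IsIntegral k⟮toFunctionField p (C X)⟯ (toFunctionField p X) := hint'.tower_top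
  rw [IntermediateField.adjoin.finrank hint]
  set m := minpoly k⟮toFunctionField p (C X)⟯ (toFunctionField p X) with hm
  choose q hq using exists_aeval_eq_coeff_minpoly (k := k) rfl hint'
  let f : k[X][X] := ∑ i ∈ Finset.range (m.natDegree + 1), C (q i) * X ^ i
  have hfp : f ∈ p := by
    rw [← toFunctionField_eq_zero_iff, ← evalAt_toFunctionField]
    have h := minpoly.aeval k⟮toFunctionField p (C X)⟯ (toFunctionField p X)
    rw [aeval_eq_sum_range] at h
    rw [← h, map_sum]
    refine Finset.sum_congr rfl fun i _ => ?_
    rw [map_mul, map_pow, evalAt_C, evalAt_X, hq, Algebra.smul_def]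
    rfl
  have hcoeff : f.coeff m.natDegree = q m.natDegree := by
    simp [f, coeff_C_mul, coeff_X_pow]
  have hf0 : f ≠ 0 := by
    intro h0
    have h1 := hq m.natDegree
    rw [← hcoeff, h0, coeff_zero, map_zero, ← hm, (minpoly.monic hint).coeff_natDegree] at h1
    simp at h1
  refine (natDegree_le_natDegree_of_mem hp hfp hf0).trans ?_
  refine natDegree_sum_le_of_forall_le _ _ fun i hi => ?_
  exact (natDegree_C_mul_X_pow_le _ _).trans (Nat.lt_succ_iff.mp (Finset.mem_range.mp hi))

/-- Since `x` is integral over `k[t]`, a valuation ring containing `k` and `t` contains the whole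
coordinate ring. -/
theorem pointsAtInfinity_eq_placesAtInfinity {f : k[X][X]} (hf : f.Monic) (hfp : f ∈ p) :
    pointsAtInfinity p = placesAtInfinity k (toFunctionField p (C X)) := by
  ext v
  refine and_congr_right fun hv => not_congr ⟨fun h => h _, fun htv g => ?_⟩
  obtain ⟨g, rfl⟩ := CoordinateRing.mk_surjective p g
  have hxv : toFunctionField p X ∈ v :=
    mem_valuationSubring_of_isIntegral_adjoin hv (by simpa using htv)
      (isIntegral_toFunctionField hf hfp)
  change toFunctionField p g ∈ v
  rw [← evalAt_toFunctionField]
  induction g using Polynomial.induction_on' with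
  | add f g hf hg => rw [map_add]; exact add_mem hf hg
  | monomial n q =>
    rw [← C_mul_X_pow_eq_monomial, map_mul, map_pow, evalAt_C, evalAt_X]
    refine v.mul_mem _ _ ?_ (pow_mem hxv n)
    exact mem_valuationSubring_of_isIntegral_adjoin hv
      (S := {toFunctionField p (C X)}) (by simpa using htv) (isIntegral_algebraMap
        (x := (⟨_, aeval_mem_adjoin_singleton k _⟩ : Algebra.adjoin k {toFunctionField p (C X)})))

theorem conjugateOn_of_orbit_eq {K Kbar : Type*} [Field K] [Field Kbar] [Algebra K Kbar]
    {p : Ideal Kbar[X][X]} [p.IsPrime] {L : IntermediateField K Kbar} (h : IsDefinedOver p L)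
    {v w : ValuationSubring (FunctionField p)}
    (heq : {u | ∃ σ : Kbar ≃ₐ[L] Kbar, u = galoisAction p L h σ • v} =
      {u | ∃ σ : Kbar ≃ₐ[L] Kbar, u = galoisAction p L h σ • w}) (E : Set (FunctionField p)) :
    ConjugateOn (galoisAction p L h) E v w := by
  have hw : w ∈ {u | ∃ σ : Kbar ≃ₐ[L] Kbar, u = galoisAction p L h σ • v} := by
    rw [heq]
    exact ⟨1, by rw [map_one, one_smul]⟩
  obtain ⟨σ, rfl⟩ := hw
  exact ⟨σ, fun z _ => (ValuationSubring.smul_mem_pointwise_smul_iff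
    (g := galoisAction p L h σ)).symm⟩

theorem finite_orbitsAtInfinity_and_le_ncard {K Kbar : Type*} [Field K] [CharZero K] [Field Kbar]
    [Algebra K Kbar] (a c : K[X]) (β : K) (hc : c.natDegree ≠ 0) (N : ℕ)
    {p : Ideal Kbar[X][X]} [p.IsPrime] (hfp : extendScalars K Kbar (preimagePoly a (C β) c N) ∈ p)
    {G : Kbar[X][X]} (hG : G.Monic) (hp : p = Ideal.span {G}) {L : IntermediateField K Kbar}
    (hL : IsDefinedOver p L) :
    (orbitsAtInfinity p L hL).Finite ∧
      1 + Real.logb 2 G.natDegree ≤ ((orbitsAtInfinity p L hL).ncard : ℝ) := by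
  rw [extendScalars_preimagePoly, map_C] at hfp
  have : CharZero Kbar := charZero_of_injective_algebraMap (algebraMap K Kbar).injective
  have hGp : G ∈ p := hp ▸ Ideal.mem_span_singleton_self G
  have := finiteDimensional_functionField hG hGp
  have hpts := pointsAtInfinity_eq_placesAtInfinity hG hGp
  have hfin : (pointsAtInfinity p).Finite := by
    rw [hpts]
    exact finite_placesAtInfinity
  have horb : orbitsAtInfinity p L hL =
      (fun v => {u | ∃ σ : Kbar ≃ₐ[L] Kbar, u = galoisAction p L hL σ • v}) ''
        pointsAtInfinity p := by
    ext O
    simp only [orbitsAtInfinity, Set.mem_ofPred_eq, Set.mem_image, eq_comm]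
  have hofin : (orbitsAtInfinity p L hL).Finite := by
    rw [horb]
    exact hfin.image _
  refine ⟨hofin, ?_⟩
  have hfix (σ : Kbar ≃ₐ[L] Kbar) {f : Kbar[X][X]} (hf : coeffAut σ f = f) :
      galoisAction p L hL σ (toFunctionField p f) = toFunctionField p f := by
    have := galoisAction_algebraMap_mk p L hL σ f
    rwa [hf] at this
  obtain ⟨T, hTsub, hT, hcard⟩ := exists_pairwise_not_conjugateOn (ρ := galoisAction p L hL)
    (transcendental_toFunctionField hG hp) (a.map (algebraMap K Kbar)) (c.map (algebraMap K Kbar))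
    (algebraMap K Kbar β) (by rwa [natDegree_map])
    (fun σ r => ⟨σ r, by
      have h := galoisAction_algebraMap_mk p L hL σ (C (C r))
      refine Eq.trans ?_ h.symm
      have : coeffAut σ (C (C r)) = C (C (σ r)) := by simp [coeffAut]
      rw [this]
      rfl⟩)
    (fun σ => hfix σ (by simp [coeffAut]))
    (fun σ => hfix σ (by simpa using coeffAut_C_map σ (C β)))
    (fun σ => by
      rw [aeval_toFunctionField]
      exact hfix σ (coeffAut_C_map σ c))
    N (x := toFunctionField p X) (fun σ => hfix σ (by simp [coeffAut]))
    (by rwa [evalAt_toFunctionField, toFunctionField_eq_zero_iff])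
  have hTle : T.card ≤ (orbitsAtInfinity p L hL).ncard := by
    rw [← Set.ncard_coe_finset]
    refine Set.ncard_le_ncard_of_injOn
      (fun v => {u | ∃ σ : Kbar ≃ₐ[L] Kbar, u = galoisAction p L hL σ • v}) ?_ ?_ hofin
    · intro v hv
      exact ⟨v, hpts ▸ hTsub hv, rfl⟩
    · intro v hv w hw hvw
      by_contra hne
      exact hT hv hw hne (conjugateOn_of_orbit_eq hL hvw _)
  -- The bound before taking logarithms; the factor 2 becomes the summand 1.
  have hdeg : 2 * G.natDegree ≤ 2 ^ (orbitsAtInfinity p L hL).ncard :=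
    (Nat.mul_le_mul_left 2 (natDegree_le_finrank hG hp)).trans
      (hcard.trans (Nat.pow_le_pow_right two_pos hTle))
  have hpos : (0 : ℝ) < G.natDegree :=
    Nat.cast_pos.mpr (Nat.pos_of_ne_zero (natDegree_ne_zero_of_monic hG hp))
  have h2 : (1 : ℝ) = Real.logb 2 2 := (Real.logb_self_eq_one one_lt_two).symm
  rw [h2, ← Real.logb_mul two_ne_zero hpos.ne', Real.logb_le_iff_le_rpow one_lt_two (by positivity),
    Real.rpow_natCast]
  exact_mod_cast hdeg

end FunctionField

end Preimage

theorem theorem4p10 {K Kbar : Type*} [Field K] [NumberField K] [Field Kbar] [Algebra K Kbar]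
    [IsAlgClosure K Kbar] (a b c : K[X]) (hb : b.natDegree = 0) (hc : c.natDegree ≠ 0)
    (N : ℕ) (hN : 1 ≤ N) (p : Ideal Kbar[X][X]) [p.IsPrime]
    (hp : p ∈ (Preimage.preimageIdeal Kbar a b c N).minimalPrimes) :
    ∃ (G : Kbar[X][X]) (L : IntermediateField K Kbar)
      (hL : IsLeast {L' : IntermediateField K Kbar | Preimage.IsDefinedOver p L'} L),
      p = Ideal.span {G} ∧ (Preimage.orbitsAtInfinity p L hL.1).Finite ∧
        1 + Real.logb 2 G.natDegree ≤ ((Preimage.orbitsAtInfinity p L hL.1).ncard : ℝ) := by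
  obtain ⟨β, rfl⟩ := natDegree_eq_zero.mp hb
  have hfp := hp.1.2 (Ideal.mem_span_singleton_self _)
  obtain ⟨G, hG, hpG⟩ := Preimage.exists_monic_eq_span_singleton_of_mem_minimalPrimes
    ((Preimage.preimagePoly_monic a (C β) c N).map _) hp
  have hL : IsLeast {L' : IntermediateField K Kbar | Preimage.IsDefinedOver p L'}
      (IntermediateField.adjoin K {z | ∃ i j, z = (G.coeff i).coeff j}) := by
    rw [hpG]
    exact Preimage.isLeast_isDefinedOver_span_singleton hG
  exact ⟨G, _, hL, hpG, Preimage.finite_orbitsAtInfinity_and_le_ncard a c β hc N hfp hG hpG hL.1⟩
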